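/- Let $R$ be an integral domain with quotient field $K$. Denote by $\mathcal F(R)$ the set of fractional ideals of $R$, that is, the $R$-submodules $I$ of $K$ such that $dI\subseteq R$ for some nonzero $d\in R$. A star operation on $R$ is a map $\star:\mathcal F(R)\to\mathcal F(R)$, $I\mapsto I^\star$, such that for all $I,J\in\mathcal F(R)$ and $x\in K$: $I\subseteq I^\star$; $(I^\star)^\star=I^\star$; if $I\subseteq J$ then $I^\star\subseteq J^\star$; $R^\star=R$; and $(xI)^\star=x\,I^\star$ (so the zero ideal is fixed by every star operation). A fractional ideal $I$ is $\star$-closed if $I^\star=I$. The $v$-operation is the star operation $I\mapsto (R:(R:I))$ for $I\neq(0)$, with $(0)^v=(0)$, where $(R:I)=\{x\in K\mid xI\subseteq R\}$; the $v$-closed fractional ideals are called divisorial. The domain $R$ is a Prüfer domain if each of its nonzero finitely generated ideals is invertible; semilocal if it has only finitely many maximal ideals; locally finite if every nonzero element of $R$ is contained in only finitely many maximal ideals; finite-dimensional if its Krull dimension is finite; and $h$-local if it is locally finite and every nonzero prime ideal of $R$ is contained in only one maximal ideal. **Proposition.** Let $R$ be a Prüfer domain, and suppose that $R$ is either (a)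 semilocal, or (b) locally finite and finite-dimensional. Then the following are equivalent: (i) $R$ is $h$-local; (ii) for every star operation $\star$ on $R$, every $I\in\mathcal F(R)$ that is not $\star$-closed and every $J\in\mathcal F(R)$, at least one of $I\cap J$ and $I+J$ is not $\star$-closed; (iii) for every $I\in\mathcal F(R)$ that is not divisorial and every $J\in\mathcal F(R)$, at least one of $I\cap J$ and $I+J$ is not divisorial. -/

import Mathlib

open scoped nonZeroDivisors

/-- A Prüfer domain: an integral domain in which every nonzero finitely generated ideal is
invertible. -/
structure IsPruferDomain (R : Type*) [CommRing R] : Prop where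
  isDomain : IsDomain R
  isUnit_of_fg : ∀ I : Ideal R, I ≠ ⊥ → I.FG →
    IsUnit (I : FractionalIdeal R⁰ (FractionRing R))

/-- `R` is locally finite (of finite character): every nonzero element of `R` lies in
(equivalently, is a nonunit in the localization at) only finitely many maximal ideals. -/
def IsLocallyFiniteDomain (R : Type*) [CommRing R] : Prop :=
  ∀ x : R, x ≠ 0 → {M : Ideal R | M.IsMaximal ∧ x ∈ M}.Finite

/-- An h-local domain: a locally finite domain in which every nonzero prime ideal is contained
in only one maximal ideal. -/
structure IsHLocalDomain (R : Type*) [CommRing R] : Prop where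
  isDomain : IsDomain R
  locallyFinite : IsLocallyFiniteDomain R
  existsUnique_maximal : ∀ P : Ideal R, P.IsPrime → P ≠ ⊥ →
    ∃! M : Ideal R, M.IsMaximal ∧ P ≤ M

/-- A star operation on the domain `R` with quotient field `K`: a map on the fractional ideals
of `R` that is extensive, idempotent and monotone, fixes `R` and satisfies `(xI)^⋆ = x I^⋆` for
all `x ∈ K` (for `x = 0` this says that the zero ideal is fixed). -/
structure StarOperation (R : Type*) [CommRing R] (K : Type*) [Field K] [Algebra R K]
    [IsFractionRing R K] where
  toFun : FractionalIdeal R⁰ K → FractionalIdeal R⁰ K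
  le_apply : ∀ I, I ≤ toFun I
  idem : ∀ I, toFun (toFun I) = toFun I
  mono : ∀ I J, I ≤ J → toFun I ≤ toFun J
  map_one : toFun 1 = 1
  map_smul : ∀ (x : K) (I), toFun (FractionalIdeal.spanSingleton R⁰ x * I) =
    FractionalIdeal.spanSingleton R⁰ x * toFun I

namespace StarOperation

section

variable {R : Type*} [CommRing R] {K : Type*} [Field K] [Algebra R K] [IsFractionRing R K]

/-- `I` is `⋆`-closed (a `⋆`-ideal) if `I = I^⋆`. -/
def IsClosed (s : StarOperation R K) (I : FractionalIdeal R⁰ K) : Prop :=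
  s.toFun I = I

end

section

variable {R : Type*} [CommRing R] [IsDomain R] {K : Type*} [Field K] [Algebra R K]
  [IsFractionRing R K]

theorem one_div_ne_zero {I : FractionalIdeal R⁰ K} (hI : I ≠ 0) : 1 / I ≠ 0 := by
  intro h
  have := FractionalIdeal.bot_lt_mul_inv (I := I) (by simpa using hI)
  rw [FractionalIdeal.inv_eq, h] at this
  simp at this

theorem mem_one_div {I : FractionalIdeal R⁰ K} (hI : I ≠ 0) {x : K} :
    x ∈ 1 / I ↔ ∀ y ∈ I, x * y ∈ (1 : FractionalIdeal R⁰ K) :=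
  FractionalIdeal.mem_div_iff_of_ne_zero hI

theorem one_div_anti {I J : FractionalIdeal R⁰ K} (hI : I ≠ 0) (hJ : J ≠ 0) (h : I ≤ J) :
    1 / J ≤ 1 / I :=
  FractionalIdeal.inv_anti_mono hI hJ h

theorem le_one_div_one_div {I : FractionalIdeal R⁰ K} (hI : I ≠ 0) : I ≤ 1 / (1 / I) := by
  intro x hx
  rw [mem_one_div (one_div_ne_zero hI)]
  intro y hy
  rw [mul_comm]
  exact (mem_one_div hI).1 hy x hx

theorem one_div_spanSingleton_mul {x : K} (hx : x ≠ 0) (I : FractionalIdeal R⁰ K) :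
    1 / (FractionalIdeal.spanSingleton R⁰ x * I) =
      FractionalIdeal.spanSingleton R⁰ x⁻¹ * (1 / I) := by
  by_cases hI : I = 0
  · simp [hI]
  have hxI : FractionalIdeal.spanSingleton R⁰ x * I ≠ 0 := by
    intro h
    apply hI
    have h' := congrArg (FractionalIdeal.spanSingleton R⁰ x⁻¹ * ·) h
    simpa [← mul_assoc, FractionalIdeal.spanSingleton_mul_spanSingleton, hx] using h'
  ext z
  rw [mem_one_div hxI, FractionalIdeal.mem_singleton_mul]
  constructor
  · intro h
    refine ⟨x * z, (mem_one_div hI).2 fun y hy => ?_, by field_simp⟩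
    have := h (x * y) (FractionalIdeal.mem_singleton_mul.2 ⟨y, hy, rfl⟩)
    rwa [mul_left_comm, ← mul_assoc] at this
  · rintro ⟨w, hw, rfl⟩ y hy
    obtain ⟨y', hy', rfl⟩ := FractionalIdeal.mem_singleton_mul.1 hy
    have h := (mem_one_div hI).1 hw y' hy'
    have e : x⁻¹ * w * (x * y') = w * y' := by field_simp
    rwa [e]

variable (R K) in
/-- The `v`-operation (divisorial closure) `I ↦ (R : (R : I))`. In Mathlib `1 / I` is the
colon ideal `(R : I)` when `I ≠ 0`, and `1 / 0 = 0`, so the zero ideal is fixed. -/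
noncomputable def vOperation : StarOperation R K where
  toFun I := 1 / (1 / I)
  le_apply I := by
    by_cases hI : I = 0
    · simp [hI]
    · exact le_one_div_one_div hI
  idem I := by
    by_cases hI : I = 0
    · simp [hI]
    · have h1 := one_div_ne_zero hI
      have h2 := one_div_ne_zero h1
      exact le_antisymm (one_div_anti h1 (one_div_ne_zero h2) (le_one_div_one_div h1))
        (le_one_div_one_div h2)
  mono I J h := by
    by_cases hI : I = 0
    · simp [hI]
    · have hJ : J ≠ 0 := by
        rintro rfl
        exact hI (FractionalIdeal.le_zero_iff.1 h)
      exact one_div_anti (one_div_ne_zero hJ) (one_div_ne_zero hI) (one_div_anti hI hJ h)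
  map_one := by simp
  map_smul x I := by
    by_cases hx : x = 0
    · simp [hx]
    · rw [one_div_spanSingleton_mul hx, one_div_spanSingleton_mul (inv_ne_zero hx), inv_inv]

end

end StarOperation

/-! A submodule of `K` is the intersection of its localizations at maximal ideals, and over a Prüfer
domain any two submodules have comparable localizations at each prime. Everything is checked
locally.

Let `R` be h-local, with `I ∩ J` and `I + J` closed, and let `M` be maximal. If `J_M ⊆ I_M`, then
`I^⋆ ⊆ I + J ⊆ I_M`. If `I_M ⊆ J_M`, h-locality gives one `s ∉ M` with `sI ⊆ I ∩ J`
(`IsHLocalDomain.exists_notMem_smul_mem`), so `s I^⋆ ⊆ I ∩ J` and again `I^⋆ ⊆ I_M`. Hence `I^⋆ =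
I`.

If `R` is locally finite but not h-local, some nonzero prime `P` lies in two maximal ideals `M₁`,
`M₂` and contains every prime shared by a maximal ideal above `P` and another one. Put `D = (R :
P)`, a divisorial ideal with `D_N = R_P` for maximal `N ⊇ P`. Let `I` be the part of `D` inside
`R_{M₁}`, and `J` the part inside all other `R_N`. Then `I ∩ J = R` and `I + J = D` are divisorial,
but `I^v = D ≠ I`: the ideal `M₂` already forces `(R : I) = (R : D)`. -/

/-! ### Localizations of submodules of `K`, elementwise -/

section LocalMembership

variable {R : Type*} [CommRing R] {K : Type*} [Field K] [Algebra R K]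

/-- `x` lies in the localization `L_P` of the submodule `L` of `K` at `P`. -/
def MemLocalization (P : Ideal R) (L : Submodule R K) (x : K) : Prop :=
  ∃ s ∉ P, s • x ∈ L

namespace MemLocalization

variable {P M : Ideal R} {L L' : Submodule R K} {x y : K}

theorem of_mem (hP : P.IsPrime) (hx : x ∈ L) : MemLocalization P L x :=
  ⟨1, (Ideal.ne_top_iff_one P).1 hP.ne_top, by simpa using hx⟩

theorem mono (h : L ≤ L') (hx : MemLocalization P L x) : MemLocalization P L' x :=
  let ⟨s, hs, hsx⟩ := hx
  ⟨s, hs, h hsx⟩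

theorem add (hP : P.IsPrime) (hx : MemLocalization P L x) (hy : MemLocalization P L y) :
    MemLocalization P L (x + y) := by
  obtain ⟨s, hs, hsx⟩ := hx
  obtain ⟨t, ht, hty⟩ := hy
  refine ⟨s * t, hP.mul_notMem hs ht, ?_⟩
  have e : (s * t) • (x + y) = t • s • x + s • t • y := by
    simp only [Algebra.smul_def, map_mul]; ring
  rw [e]
  exact L.add_mem (L.smul_mem _ hsx) (L.smul_mem _ hty)

theorem smul (r : R) (hx : MemLocalization P L x) : MemLocalization P L (r • x) := by
  obtain ⟨s, hs, hsx⟩ := hx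
  exact ⟨s, hs, by rw [smul_comm]; exact L.smul_mem _ hsx⟩

theorem of_smul (hP : P.IsPrime) {r : R} (hr : r ∉ P) (hx : MemLocalization P L (r • x)) :
    MemLocalization P L x := by
  obtain ⟨s, hs, hsx⟩ := hx
  exact ⟨s * r, hP.mul_notMem hs hr, by rwa [mul_smul]⟩

theorem mul (hP : P.IsPrime) (hx : MemLocalization P 1 x) (hy : MemLocalization P L y) :
    MemLocalization P L (x * y) := by
  obtain ⟨s, hs, hsx⟩ := hx
  obtain ⟨t, ht, hty⟩ := hy
  obtain ⟨r, hr⟩ := Submodule.mem_one.1 hsx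
  refine ⟨s * t, hP.mul_notMem hs ht, ?_⟩
  have e : (s * t) • (x * y) = r • t • y := by
    simp only [Algebra.smul_def, map_mul] at hr ⊢
    rw [hr]; ring
  rw [e]
  exact L.smul_mem _ hty

theorem of_algebraMap (hP : P.IsPrime) (r : R) : MemLocalization P 1 (algebraMap R K r) :=
  of_mem hP (Submodule.mem_one.2 ⟨r, rfl⟩)

/-- If `x ∉ L`, the conductor of `x` into `L` is proper, and `x ∉ L_M` for any maximal `M`
containing it. -/
theorem mem_of_forall_maximal
    (h : ∀ M : Ideal R, M.IsMaximal → MemLocalization M L x) : x ∈ L := by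
  by_contra hx
  let A : Ideal R := L.comap (LinearMap.toSpanSingleton R K x)
  have hA : A ≠ ⊤ := by
    intro e
    have : (1 : R) ∈ A := e ▸ Submodule.mem_top
    exact hx (by simpa [A] using this)
  obtain ⟨M, hM, hAM⟩ := Ideal.exists_le_maximal A hA
  obtain ⟨s, hs, hsx⟩ := h M hM
  exact hs (hAM (by simpa [A] using hsx))

variable [IsFractionRing R K]

theorem not_inv_algebraMap {t : R} (ht : t ∈ M) (ht0 : t ≠ 0) :
    ¬ MemLocalization M 1 (algebraMap R K t)⁻¹ := by
  rintro ⟨s, hs, hsx⟩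
  obtain ⟨r, hr⟩ := Submodule.mem_one.1 hsx
  have ht' : algebraMap R K t ≠ 0 := by
    simpa using ht0
  have : r * t = s := by
    apply IsFractionRing.injective R K
    rw [map_mul, hr, Algebra.smul_def]
    field_simp
  exact hs (this ▸ M.mul_mem_left _ ht)

end MemLocalization

end LocalMembership

/-! ### Localizations of a Prüfer domain are valuation rings -/

section Pruefer

variable {R : Type*} [CommRing R]

/-- Divisibility in `R_P` is total. Let `J` be the inverse of `(a, b)`. For `u ∈ J` the elements `p
= au` and `q = bu` of `R` satisfy `pb = qa`; if all of them lay in `P`, then `R = (a, b)J ⊆ P`. -/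
theorem IsPruferDomain.exists_mul_eq_mul (hR : IsPruferDomain R) {P : Ideal R} (hP : P.IsPrime)
    (a b : R) : ∃ s ∉ P, ∃ c, s * a = c * b ∨ s * b = c * a := by
  by_cases ha : a = 0
  · exact ⟨1, (Ideal.ne_top_iff_one P).1 hP.ne_top, 0, Or.inl (by simp [ha])⟩
  obtain ⟨J, hJ⟩ := (hR.isUnit_of_fg (Ideal.span {a, b})
    (fun h => ha (by
      have : a ∈ Ideal.span {a, b} := Ideal.subset_span (by simp)
      simpa [h] using this)) (Submodule.fg_span (Set.toFinite _))).exists_right_inv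
  let f := algebraMap R (FractionRing R)
  have hint : ∀ c ∈ Ideal.span {a, b}, ∀ u ∈ J, ∃ r, f r = f c * u := fun c hc u hu => by
    have : f c * u ∈ (1 : FractionalIdeal R⁰ (FractionRing R)) :=
      hJ ▸ FractionalIdeal.mul_mem_mul (FractionalIdeal.mem_coeIdeal_of_mem _ hc) hu
    simpa [FractionalIdeal.mem_one_iff] using this
  have ha' : a ∈ Ideal.span {a, b} := Ideal.subset_span (by simp)
  have hb' : b ∈ Ideal.span {a, b} := Ideal.subset_span (by simp)
  by_contra! hcon
  have key : ∀ u ∈ J, (∀ r, f r = f a * u → r ∈ P) ∧ (∀ r, f r = f b * u → r ∈ P) := by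
    intro u hu
    obtain ⟨p, hp⟩ := hint a ha' u hu
    obtain ⟨q, hq⟩ := hint b hb' u hu
    have hpq : p * b = q * a := by
      apply IsFractionRing.injective R (FractionRing R)
      rw [map_mul, map_mul]
      change f p * f b = f q * f a
      rw [hp, hq]; ring
    refine ⟨fun r hr => ?_, fun r hr => ?_⟩
    · have : r = p := IsFractionRing.injective R (FractionRing R) (hr.trans hp.symm)
      by_contra h
      exact (hcon p (this ▸ h) q).2 hpq
    · have : r = q := IsFractionRing.injective R (FractionRing R) (hr.trans hq.symm)
      by_contra h
      exact (hcon q (this ▸ h) p).1 hpq.symm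
  have hle : ((Ideal.span {a, b} : Ideal R) : FractionalIdeal R⁰ (FractionRing R)) * J ≤ P := by
    rw [FractionalIdeal.mul_le]
    intro i hi u hu
    obtain ⟨c, hc, rfl⟩ := (FractionalIdeal.mem_coeIdeal _).1 hi
    obtain ⟨x, y, rfl⟩ := Ideal.mem_span_pair.1 hc
    obtain ⟨p, hp⟩ := hint a ha' u hu
    obtain ⟨q, hq⟩ := hint b hb' u hu
    refine (FractionalIdeal.mem_coeIdeal _).2 ⟨x * p + y * q,
      P.add_mem (P.mul_mem_left _ ((key u hu).1 p hp)) (P.mul_mem_left _ ((key u hu).2 q hq)), ?_⟩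
    simp only [map_add, map_mul]
    change _ * f p + _ * f q = (_ * f a + _ * f b) * u
    rw [hp, hq]; ring
  rw [hJ, FractionalIdeal.one_le] at hle
  obtain ⟨r, hr, hr1⟩ := (FractionalIdeal.mem_coeIdeal _).1 hle
  have : r = 1 := IsFractionRing.injective R (FractionRing R) (by simpa using hr1)
  exact hP.ne_top ((Ideal.eq_top_iff_one P).2 (this ▸ hr))

/-- The prime ideals of a Prüfer domain contained in a given prime ideal form a chain. -/
theorem IsPruferDomain.le_or_le_of_le (hR : IsPruferDomain R) {P Q M : Ideal R} (hP : P.IsPrime)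
    (hQ : Q.IsPrime) (hM : M.IsPrime) (hPM : P ≤ M) (hQM : Q ≤ M) : P ≤ Q ∨ Q ≤ P := by
  by_contra! h
  obtain ⟨a, haP, haQ⟩ := Set.not_subset.1 h.1
  obtain ⟨b, hbQ, hbP⟩ := Set.not_subset.1 h.2
  obtain ⟨s, hs, c, e | e⟩ := hR.exists_mul_eq_mul hM a b
  · exact hQ.mul_notMem (fun h => hs (hQM h)) haQ (e ▸ Q.mul_mem_left c hbQ)
  · exact hP.mul_notMem (fun h => hs (hPM h)) hbP (e ▸ P.mul_mem_left c haP)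

variable [IsDomain R] {K : Type*} [Field K] [Algebra R K] [IsFractionRing R K]

theorem IsPruferDomain.memLocalization_or_inv (hR : IsPruferDomain R) {P : Ideal R}
    (hP : P.IsPrime) (x : K) : MemLocalization P 1 x ∨ MemLocalization P 1 x⁻¹ := by
  obtain ⟨a, b, hb, rfl⟩ := IsFractionRing.div_surjective (A := R) x
  have hb0 : algebraMap R K b ≠ 0 := by simpa using nonZeroDivisors.ne_zero hb
  by_cases ha : a = 0
  · left; simpa [ha] using MemLocalization.of_mem hP (zero_mem (1 : Submodule R K))
  have ha0 : algebraMap R K a ≠ 0 := by simpa using ha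
  obtain ⟨s, hs, c, e | e⟩ := hR.exists_mul_eq_mul hP a b
  · refine Or.inl ⟨s, hs, Submodule.mem_one.2 ⟨c, ?_⟩⟩
    have := congrArg (algebraMap R K) e
    simp only [map_mul] at this
    rw [Algebra.smul_def]; field_simp; exact this.symm
  · refine Or.inr ⟨s, hs, Submodule.mem_one.2 ⟨c, ?_⟩⟩
    have := congrArg (algebraMap R K) e
    simp only [map_mul] at this
    rw [Algebra.smul_def]; field_simp; exact this.symm

/-- The localizations of two submodules at a prime ideal of a Prüfer domain are comparable. -/
theorem IsPruferDomain.memLocalization_total (hR : IsPruferDomain R) {P : Ideal R}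
    (hP : P.IsPrime) (L L' : Submodule R K) :
    (∀ x, MemLocalization P L x → MemLocalization P L' x) ∨
      ∀ x, MemLocalization P L' x → MemLocalization P L x := by
  by_contra! h
  obtain ⟨⟨x, hx, hx'⟩, y, hy, hy'⟩ := h
  have hx0 : x ≠ 0 := by
    rintro rfl; exact hx' (.of_mem hP L'.zero_mem)
  have hy0 : y ≠ 0 := by
    rintro rfl; exact hy' (.of_mem hP L.zero_mem)
  rcases hR.memLocalization_or_inv hP (x / y) with h | h
  · exact hx' (by simpa [hy0] using h.mul hP hy)
  · exact hy' (by simpa [hx0] using h.mul hP hx)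

theorem IsPruferDomain.memLocalization_inv_of_not_mem (hR : IsPruferDomain R) {P : Ideal R}
    (hP : P.IsPrime) {x : K} (hx : ¬ MemLocalization P (P : FractionalIdeal R⁰ K) x) :
    MemLocalization P 1 x⁻¹ := by
  rcases hR.memLocalization_or_inv hP x with ⟨s, hs, hsx⟩ | h
  · obtain ⟨r, hr⟩ := Submodule.mem_one.1 hsx
    have hx0 : x ≠ 0 := by
      rintro rfl; exact hx (.of_mem hP (zero_mem _))
    refine ⟨r, fun hrP => hx ⟨s, hs, ?_⟩, Submodule.mem_one.2 ⟨s, ?_⟩⟩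
    · rw [← hr]; exact FractionalIdeal.mem_coeIdeal_of_mem _ hrP
    · rw [Algebra.smul_def, hr, Algebra.smul_def]; field_simp
  · exact h

theorem IsPruferDomain.memLocalization_inv_mem (hR : IsPruferDomain R) {P : Ideal R}
    (hP : P.IsPrime) {x : K} (hx : ¬ MemLocalization P 1 x) :
    MemLocalization P (P : FractionalIdeal R⁰ K) x⁻¹ := by
  by_contra h
  exact hx (by simpa using hR.memLocalization_inv_of_not_mem hP h)

/-- For primes `P ≤ M` of a Prüfer domain, `P_P ⊆ P_M`. -/
theorem IsPruferDomain.memLocalization_of_le (hR : IsPruferDomain R) {P M : Ideal R}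
    (hP : P.IsPrime) (hM : M.IsPrime) (hPM : P ≤ M) {y : K}
    (hy : MemLocalization P (P : FractionalIdeal R⁰ K) y) :
    MemLocalization M (P : FractionalIdeal R⁰ K) y := by
  by_cases hy0 : y = 0
  · subst hy0; exact .of_mem hM (zero_mem _)
  obtain ⟨s, hs, hsy⟩ := hy
  obtain ⟨p, hp, hpy⟩ := (FractionalIdeal.mem_coeIdeal _).1 hsy
  rw [Algebra.smul_def] at hpy
  -- Here `sy = p ∈ P`. If `ty = r ∈ R`, then `sr = tp` puts `r` in `P`; if `t y⁻¹ = r ∈ R`, then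
  -- `st = pr ∈ P`, which is impossible.
  rcases hR.memLocalization_or_inv hM y with ⟨t, ht, hty⟩ | ⟨t, ht, hty⟩
  · obtain ⟨r, hr⟩ := Submodule.mem_one.1 hty
    refine ⟨t, ht, ?_⟩
    rw [← hr]
    refine FractionalIdeal.mem_coeIdeal_of_mem _ ?_
    have e : s * r = t * p := by
      apply IsFractionRing.injective R K
      rw [map_mul, map_mul, hr, hpy, Algebra.smul_def]; ring
    exact (hP.mem_or_mem (e ▸ P.mul_mem_left t hp : s * r ∈ P)).resolve_left hs
  · obtain ⟨r, hr⟩ := Submodule.mem_one.1 hty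
    have e : s * t = p * r := by
      apply IsFractionRing.injective R K
      rw [map_mul, map_mul, hr, hpy, Algebra.smul_def]; field_simp
    exact absurd (e ▸ P.mul_mem_right r hp : s * t ∈ P)
      (hP.mul_notMem hs fun h => ht (hPM h))

end Pruefer

/-! ### Multipliers outside one maximal ideal -/

section Avoidance

variable {R : Type*} [CommRing R]

/-- Otherwise `A` misses the monoid generated by the complements of `M` and `N`, and a prime above
`A` disjoint from that monoid lies in both. -/
theorem Ideal.exists_mul_mem_of_forall_prime {A M N : Ideal R} (hM : M.IsPrime) (hN : N.IsPrime)
    (h : ∀ P : Ideal R, P.IsPrime → P ≤ M → P ≤ N → ¬ A ≤ P) :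
    ∃ s ∉ M, ∃ t ∉ N, s * t ∈ A := by
  by_contra! hcon
  obtain ⟨P, hP, hAP, hdisj⟩ := A.exists_le_prime_disjoint (M.primeCompl ⊔ N.primeCompl) (by
    rw [Set.disjoint_right]
    intro x hx hxA
    obtain ⟨s, hs, t, ht, rfl⟩ := Submonoid.mem_sup.1 hx
    exact hcon s hs t ht hxA)
  rw [Set.disjoint_left] at hdisj
  refine h P hP (fun x hx => ?_) (fun x hx => ?_) hAP
  · by_contra hxM
    exact hdisj hx (SetLike.le_def.1 le_sup_left hxM)
  · by_contra hxN
    exact hdisj hx (SetLike.le_def.1 le_sup_right hxN)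

/-- In a locally finite domain, if no prime containing the nonzero ideal `A` is contained both in
`M` and in another maximal ideal, then some `s ∉ M` lies in `A_N` for all maximal `N ≠ M`. -/
theorem IsLocallyFiniteDomain.exists_notMem_forall_maximal (hR : IsLocallyFiniteDomain R)
    {A M : Ideal R} (hA : A ≠ ⊥) (hM : M.IsPrime)
    (h : ∀ N : Ideal R, N.IsMaximal → N ≠ M → ∀ P : Ideal R, P.IsPrime → P ≤ M → P ≤ N → ¬ A ≤ P) :
    ∃ s ∉ M, ∀ N : Ideal R, N.IsMaximal → N ≠ M → ∃ t ∉ N, s * t ∈ A := by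
  obtain ⟨a, ha, ha0⟩ := Submodule.exists_mem_ne_zero_of_ne_bot hA
  have hfin := hR a ha0
  -- Only the finitely many maximal ideals containing `a` constrain `s`; at all others `t = a`
  -- works.
  have key : ∀ F : Finset (Ideal R), (∀ N ∈ F, N.IsMaximal ∧ N ≠ M) →
      ∃ s ∉ M, ∀ N ∈ F, ∃ t ∉ N, s * t ∈ A := by
    classical
    intro F
    induction F using Finset.induction_on with
    | empty => exact fun _ => ⟨1, (Ideal.ne_top_iff_one M).1 hM.ne_top, by simp⟩
    | insert N F _ ih =>
      intro hF
      obtain ⟨s, hs, hsF⟩ := ih fun N' hN' => hF N' (Finset.mem_insert_of_mem hN')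
      obtain ⟨hN, hNM⟩ := hF N (Finset.mem_insert_self _ _)
      obtain ⟨u, hu, t, ht, hut⟩ := Ideal.exists_mul_mem_of_forall_prime hM hN.isPrime (h N hN hNM)
      refine ⟨s * u, hM.mul_notMem hs hu, fun N' hN' => ?_⟩
      rcases Finset.mem_insert.1 hN' with rfl | hN'
      · exact ⟨t, ht, by rw [mul_assoc]; exact A.mul_mem_left s hut⟩
      · obtain ⟨t', ht', hst⟩ := hsF N' hN'
        exact ⟨t', ht', by rw [mul_right_comm]; exact A.mul_mem_right u hst⟩
  obtain ⟨s, hs, hsF⟩ := key (hfin.toFinset.filter (· ≠ M))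
    (fun N hN => by
      simp only [Finset.mem_filter, Set.Finite.mem_toFinset, Set.mem_ofPred_eq] at hN
      exact ⟨hN.1.1, hN.2⟩)
  refine ⟨s, hs, fun N hN hNM => ?_⟩
  by_cases haN : a ∈ N
  · exact hsF N (by simp [hN, haN, hNM])
  · exact ⟨a, haN, A.mul_mem_left s ha⟩

theorem IsLocallyFiniteDomain.of_finite_maximalSpectrum (h : Finite (MaximalSpectrum R)) :
    IsLocallyFiniteDomain R := fun x _ => by
  refine (Set.finite_range (MaximalSpectrum.asIdeal (R := R))).subset ?_
  rintro M ⟨hM, -⟩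
  exact ⟨⟨M, hM⟩, rfl⟩

end Avoidance

/-! ### Star operations on h-local Prüfer domains -/

section HLocal

variable {R : Type*} [CommRing R] {K : Type*} [Field K] [Algebra R K]

theorem FractionalIdeal.exists_smul_mem_one [Nontrivial R] (I : FractionalIdeal R⁰ K) :
    ∃ d : R, d ≠ 0 ∧ ∀ x ∈ I, d • x ∈ (1 : Submodule R K) := by
  obtain ⟨d, hd, h⟩ := I.isFractional
  refine ⟨d, nonZeroDivisors.ne_zero hd, fun x hx => ?_⟩
  obtain ⟨r, hr⟩ := h x hx
  exact Submodule.mem_one.2 ⟨r, hr⟩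

/-- The ideal of all `r` with `r • x ∈ L`. -/
def conductorInto (L : Submodule R K) (x : K) : Ideal R :=
  L.comap (LinearMap.toSpanSingleton R K x)

theorem mem_conductorInto {L : Submodule R K} {x : K} {r : R} :
    r ∈ conductorInto L x ↔ r • x ∈ L := Iff.rfl

theorem IsHLocalDomain.eq_of_le (hR : IsHLocalDomain R) {P M N : Ideal R} (hP : P.IsPrime)
    (hP0 : P ≠ ⊥) (hM : M.IsMaximal) (hN : N.IsMaximal) (hPM : P ≤ M) (hPN : P ≤ N) : M = N :=
  (hR.existsUnique_maximal P hP hP0).unique ⟨hM, hPM⟩ ⟨hN, hPN⟩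

variable [IsFractionRing R K]

namespace StarOperation

/-- Homogeneity and monotonicity. A star operation need not respect localization, so a local
inclusion is usable only through one multiplier valid on all of `I`. -/
theorem smul_mem_toFun (s : StarOperation R K) {I L : FractionalIdeal R⁰ K} {r : R}
    (h : ∀ x ∈ I, r • x ∈ L) {x : K} (hx : x ∈ s.toFun I) : r • x ∈ s.toFun L := by
  have hle : FractionalIdeal.spanSingleton R⁰ (algebraMap R K r) * I ≤ L :=
    FractionalIdeal.spanSingleton_mul_le_iff.2 fun x hx => by
      rw [← Algebra.smul_def]; exact h x hx
  have := s.mono _ _ hle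
  rw [s.map_smul] at this
  rw [Algebra.smul_def]
  exact FractionalIdeal.spanSingleton_mul_le_iff.1 this x hx

theorem isClosed_zero (s : StarOperation R K) : s.IsClosed 0 := by
  simpa [IsClosed] using s.map_smul 0 0

end StarOperation

variable [IsDomain R]

theorem conductorInto_ne_bot {L : Submodule R K} (hL : L ≠ ⊥) (x : K) :
    conductorInto L x ≠ ⊥ := by
  obtain ⟨y, hy, hy0⟩ := Submodule.exists_mem_ne_zero_of_ne_bot hL
  by_cases hx : x = 0
  · subst hx
    intro h
    have : (1 : R) ∈ conductorInto L (0 : K) := mem_conductorInto.2 (by simp)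
    rw [h] at this
    exact one_ne_zero this
  obtain ⟨a, b, hb, hab⟩ := IsFractionRing.div_surjective (A := R) (y / x)
  have hb0 : algebraMap R K b ≠ 0 := by simpa using nonZeroDivisors.ne_zero hb
  have e : a • x = b • y := by
    rw [Algebra.smul_def, Algebra.smul_def]
    field_simp at hab
    exact hab
  intro h
  have : a ∈ conductorInto L x := mem_conductorInto.2 (e ▸ L.smul_mem b hy)
  rw [h, Submodule.mem_bot] at this
  rw [this, zero_smul, Algebra.smul_def] at e
  exact (mul_ne_zero hb0 hy0) e.symm

/-- `I` need not be finitely generated, so a common `s` is not automatic. With `dI ⊆ R`, the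
conductor of `d⁻¹` into `L` is nonzero, and by h-locality no prime above it lies in two maximal
ideals. So some `s ∉ M` has `s d⁻¹ ∈ L_N`, hence `sI ⊆ L_N`, for all `N ≠ M`; at `M` the hypothesis
suffices. -/
theorem IsHLocalDomain.exists_notMem_smul_mem (hR : IsHLocalDomain R) {M : Ideal R}
    (hM : M.IsMaximal) {I L : FractionalIdeal R⁰ K} (hL : L ≠ 0)
    (h : ∀ x ∈ I, MemLocalization M (L : Submodule R K) x) :
    ∃ s ∉ M, ∀ x ∈ I, s • x ∈ L := by
  obtain ⟨d, hd0, hd⟩ := I.exists_smul_mem_one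
  have hdK : algebraMap R K d ≠ 0 := by simpa using hd0
  have hA := conductorInto_ne_bot (FractionalIdeal.coeToSubmodule_ne_bot.2 hL) (algebraMap R K d)⁻¹
  obtain ⟨s, hs, hsN⟩ := hR.locallyFinite.exists_notMem_forall_maximal hA hM.isPrime
    (fun N hN hNM P hP hPM hPN hAP =>
      hNM (hR.eq_of_le hP (fun h0 => hA (le_bot_iff.1 (h0 ▸ hAP))) hN hM hPN hPM))
  refine ⟨s, hs, fun x hx => ?_⟩
  refine MemLocalization.mem_of_forall_maximal (L := (L : Submodule R K)) fun N hN => ?_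
  by_cases hNM : N = M
  · exact hNM ▸ (h x hx).smul s
  obtain ⟨t, ht, hst⟩ := hsN N hN hNM
  refine ⟨t, ht, ?_⟩
  obtain ⟨r, hr⟩ := Submodule.mem_one.1 (hd x hx)
  have e : t • s • x = r • (s * t) • (algebraMap R K d)⁻¹ := by
    simp only [Algebra.smul_def, map_mul] at hr ⊢
    rw [hr]; field_simp
  rw [e]
  exact (L : Submodule R K).smul_mem r hst

theorem IsHLocalDomain.isClosed_of_inf_of_add (hR : IsHLocalDomain R) (hPr : IsPruferDomain R)
    (s : StarOperation R K) {I J : FractionalIdeal R⁰ K} (hinf : s.IsClosed (I ⊓ J))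
    (hadd : s.IsClosed (I + J)) : s.IsClosed I := by
  by_cases hI : I = 0
  · exact hI ▸ s.isClosed_zero
  by_cases hJ : J = 0
  · simpa [hJ] using hadd
  have hinf0 : I ⊓ J ≠ 0 := by
    obtain ⟨x, hx, hx0⟩ := Submodule.exists_mem_ne_zero_of_ne_bot
      (FractionalIdeal.coeToSubmodule_ne_bot.2 hI)
    have hA := conductorInto_ne_bot (FractionalIdeal.coeToSubmodule_ne_bot.2 hJ) x
    obtain ⟨a, ha, ha0⟩ := Submodule.exists_mem_ne_zero_of_ne_bot hA
    intro h
    have hmem : a • x ∈ I ⊓ J := by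
      change a • x ∈ ((I ⊓ J : FractionalIdeal R⁰ K) : Submodule R K)
      rw [FractionalIdeal.coe_inf]
      exact ⟨(I : Submodule R K).smul_mem a hx, ha⟩
    rw [h, FractionalIdeal.mem_zero_iff, Algebra.smul_def] at hmem
    have : algebraMap R K a ≠ 0 := by simpa using ha0
    exact mul_ne_zero this hx0 hmem
  have hadd0 : I + J ≠ 0 := fun h => hI (FractionalIdeal.le_zero_iff.1
    (h ▸ FractionalIdeal.sup_eq_add I J ▸ le_sup_left))
  refine le_antisymm (fun x hx => ?_) (s.le_apply I)
  refine MemLocalization.mem_of_forall_maximal (L := (I : Submodule R K)) fun M hM => ?_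
  rcases hPr.memLocalization_total hM.isPrime (I : Submodule R K) (J : Submodule R K) with h | h
  · obtain ⟨r, hr, hrI⟩ := hR.exists_notMem_smul_mem hM hinf0 (I := I) fun y hy => by
      obtain ⟨t, ht, hty⟩ := h y (.of_mem hM.isPrime hy)
      refine ⟨t, ht, ?_⟩
      rw [FractionalIdeal.coe_inf]
      exact ⟨(I : Submodule R K).smul_mem t hy, hty⟩
    have := s.smul_mem_toFun hrI hx
    rw [hinf] at this
    exact ⟨r, hr, (inf_le_left : I ⊓ J ≤ I) this⟩
  · have := s.mono I (I + J) (FractionalIdeal.sup_eq_add I J ▸ le_sup_left) hx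
    rw [hadd, FractionalIdeal.mem_add] at this
    obtain ⟨i, hi, j, hj, rfl⟩ := this
    exact .add hM.isPrime (.of_mem hM.isPrime hi) (h j (.of_mem hM.isPrime hj))

end HLocal

/-! ### Existence of a branching prime -/

section Branching

variable {R : Type*} [CommRing R]

/-- A prime `P ≠ ⊥` lies at a branching of `Spec R`: it is contained in two distinct
maximal ideals, and it contains every prime lying in some `M ≥ P` and in another maximal ideal. -/
structure Ideal.IsBranchPrime (P : Ideal R) : Prop where
  isPrime : P.IsPrime
  ne_bot : P ≠ ⊥
  exists_two : ∃ M N : Ideal R, M.IsMaximal ∧ N.IsMaximal ∧ M ≠ N ∧ P ≤ M ∧ P ≤ N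
  le_of_le : ∀ M N Q : Ideal R, M.IsMaximal → N.IsMaximal → M ≠ N → P ≤ M → Q.IsPrime →
    Q ≤ M → Q ≤ N → Q ≤ P

/-- In a locally finite Prüfer domain that is not h-local, there is a branching prime. -/
theorem IsPruferDomain.exists_isBranchPrime [IsDomain R] (hR : IsPruferDomain R)
    (hfin : IsLocallyFiniteDomain R) (h : ¬ IsHLocalDomain R) :
    ∃ P : Ideal R, P.IsBranchPrime := by
  let V : Ideal R → Set (Ideal R) := fun P => {M | M.IsMaximal ∧ P ≤ M}
  have hV : ∀ P, P ≠ ⊥ → (V P).Finite := fun P hP => by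
    obtain ⟨a, ha, ha0⟩ := Submodule.exists_mem_ne_zero_of_ne_bot hP
    exact (hfin a ha0).subset fun M hM => ⟨hM.1, hM.2 ha⟩
  let S : Set (Ideal R) := {P | P.IsPrime ∧ P ≠ ⊥ ∧ (V P).Nontrivial}
  have hS : S.Nonempty := by
    by_contra hS
    refine h ⟨inferInstance, hfin, fun P hP hP0 => ?_⟩
    obtain ⟨M, hM, hPM⟩ := P.exists_le_maximal hP.ne_top
    refine ⟨M, ⟨hM, hPM⟩, fun N hN => ?_⟩
    by_contra hNM
    exact hS ⟨P, hP, hP0, N, hN, M, ⟨hM, hPM⟩, hNM⟩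
  -- With as few maximal ideals above `P` as possible, any larger prime still lying in two maximal
  -- ideals lies in exactly the same ones as `P`.
  obtain ⟨P, ⟨hP, hP0, hPV⟩, hmin⟩ :=
    exists_minimalFor_of_wellFoundedLT (fun P => P ∈ S) (fun P => (V P).ncard) hS
  -- the primes above `P` with the same maximal ideals above them form a chain
  let C : Set (Ideal R) := {Q | Q.IsPrime ∧ P ≤ Q ∧ ∀ M ∈ V P, Q ≤ M}
  have hPC : P ∈ C := ⟨hP, le_rfl, fun M hM => hM.2⟩
  obtain ⟨M₀, hM₀, N₀, hN₀, hne⟩ := hPV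
  have hchain : IsChain (· ≤ ·) C := fun Q hQ Q' hQ' _ =>
    hR.le_or_le_of_le hQ.1 hQ'.1 hM₀.1.isPrime (hQ.2.2 M₀ hM₀) (hQ'.2.2 M₀ hM₀)
  have hmem : ∀ x, x ∈ sSup C ↔ ∃ Q ∈ C, x ∈ Q := fun x =>
    Submodule.mem_sSup_of_directed ⟨P, hPC⟩ hchain.directedOn
  have hle : ∀ M ∈ V P, sSup C ≤ M := fun M hM => sSup_le fun Q hQ => hQ.2.2 M hM
  have hPle : P ≤ sSup C := le_sSup hPC
  have hprime : (sSup C).IsPrime := by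
    refine ⟨fun htop => hM₀.1.ne_top (top_le_iff.1 (htop ▸ hle M₀ hM₀)), fun {x y} hxy => ?_⟩
    obtain ⟨Q, hQ, hxyQ⟩ := (hmem _).1 hxy
    exact (hQ.1.mem_or_mem hxyQ).imp (fun h => (hmem _).2 ⟨Q, hQ, h⟩)
      fun h => (hmem _).2 ⟨Q, hQ, h⟩
  refine ⟨sSup C, hprime, fun h0 => hP0 (le_bot_iff.1 (h0 ▸ hPle)),
    ⟨M₀, N₀, hM₀.1, hN₀.1, hne, hle _ hM₀, hle _ hN₀⟩, fun M N Q hM hN hMN hCM hQ hQM hQN => ?_⟩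
  -- Even if `Q` contains `sSup C`, minimality gives `V Q = V P`, so `Q ∈ C`.
  rcases hR.le_or_le_of_le hQ hprime hM.isPrime hQM hCM with h | h
  · exact h
  have hPQ : P ≤ Q := hPle.trans h
  have hsub : V Q ⊆ V P := fun M hM => ⟨hM.1, hPQ.trans hM.2⟩
  have hcard : (V P).ncard ≤ (V Q).ncard :=
    hmin ⟨hQ, fun h0 => hP0 (le_bot_iff.1 (h0 ▸ hPQ)), M, ⟨hM, hQM⟩, N, ⟨hN, hQN⟩, hMN⟩
      (Set.ncard_le_ncard hsub (hV P hP0))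
  have heq := Set.eq_of_subset_of_ncard_le hsub hcard (hV P hP0)
  exact le_sSup ⟨hQ, hPQ, fun M hM => (heq ▸ hM : M ∈ V Q).2⟩

end Branching

/-! ### The counterexample for the `v`-operation -/

section Divisorial

variable {R : Type*} [CommRing R] {K : Type*} [Field K] [Algebra R K]

/-- The elements of the fractional ideal `D` that lie in `R_N` for all primes `N ∈ S`. -/
def FractionalIdeal.restrictLocal (D : FractionalIdeal R⁰ K) (S : Set (Ideal R))
    (hS : ∀ N ∈ S, N.IsPrime) : FractionalIdeal R⁰ K :=
  ⟨{ carrier := {x | x ∈ D ∧ ∀ N ∈ S, MemLocalization N 1 x}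
     add_mem' := fun hx hy => ⟨(D : Submodule R K).add_mem hx.1 hy.1,
       fun N hN => (hx.2 N hN).add (hS N hN) (hy.2 N hN)⟩
     zero_mem' := ⟨(D : Submodule R K).zero_mem, fun N hN => .of_mem (hS N hN) (1 : Submodule R K).zero_mem⟩
     smul_mem' := fun r _ hx => ⟨(D : Submodule R K).smul_mem r hx.1,
       fun N hN => (hx.2 N hN).smul r⟩ },
    FractionalIdeal.isFractional_of_le (J := D) fun _ hx => hx.1⟩

theorem FractionalIdeal.mem_restrictLocal {D : FractionalIdeal R⁰ K} {S : Set (Ideal R)}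
    {hS : ∀ N ∈ S, N.IsPrime} {x : K} :
    x ∈ D.restrictLocal S hS ↔ x ∈ D ∧ ∀ N ∈ S, MemLocalization N 1 x := Iff.rfl

/-- An element of `R_P` can be moved into `R_N` for all maximal `N ≠ M` by some `s ∉ M`. -/
theorem Ideal.IsBranchPrime.exists_notMem_forall_memLocalization {P : Ideal R} (hP : P.IsBranchPrime)
    (hfin : IsLocallyFiniteDomain R) {M : Ideal R} (hM : M.IsMaximal) (hPM : P ≤ M) {x : K}
    (hx : MemLocalization P 1 x) :
    ∃ s ∉ M, ∀ N : Ideal R, N.IsMaximal → N ≠ M → MemLocalization N 1 (s • x) := by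
  obtain ⟨b, hbP, hb⟩ := hx
  have hA : conductorInto (1 : Submodule R K) x ≠ ⊥ := fun h =>
    hbP (by
      have : b ∈ conductorInto (1 : Submodule R K) x := hb
      rw [h, Ideal.mem_bot] at this
      exact this ▸ P.zero_mem)
  -- A prime above the conductor contains `b ∉ P`, whereas a prime shared by `M` and `N` lies in
  -- `P`.
  obtain ⟨s, hs, hsN⟩ := hfin.exists_notMem_forall_maximal hA hM.isPrime
    fun N hN hNM Q hQ hQM hQN hAQ =>
      hbP (hP.le_of_le M N Q hM hN (Ne.symm hNM) hPM hQ hQM hQN (hAQ hb))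
  refine ⟨s, hs, fun N hN hNM => ?_⟩
  obtain ⟨t, ht, hst⟩ := hsN N hN hNM
  exact ⟨t, ht, by rw [← mul_smul, mul_comm]; exact hst⟩

variable [IsDomain R] [IsFractionRing R K]

/-- For primes `P < M` of a Prüfer domain, `z R_P ⊆ R_M` forces `z ∈ P_P`. -/
theorem IsPruferDomain.memLocalization_of_forall_mul (hR : IsPruferDomain R) {P M : Ideal R}
    (hP : P.IsPrime) (hPM : P < M) {z : K}
    (hz : ∀ w, MemLocalization P 1 w → MemLocalization M 1 (z * w)) :
    MemLocalization P (P : FractionalIdeal R⁰ K) z := by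
  by_contra hcon
  have hz0 : z ≠ 0 := by
    rintro rfl; exact hcon (.of_mem hP (zero_mem _))
  obtain ⟨t, htM, htP⟩ := Set.exists_of_ssubset hPM
  have ht0 : t ≠ 0 := fun h => htP (h ▸ P.zero_mem)
  have htK : algebraMap R K t ≠ 0 := by simpa using ht0
  -- The test element `w = z⁻¹ t⁻¹` lies in `R_P`, but `zw = t⁻¹ ∉ R_M` since `t ∈ M`.
  have h1 : MemLocalization P 1 (z⁻¹ * (algebraMap R K t)⁻¹) := by
    refine .mul hP (hR.memLocalization_inv_of_not_mem hP hcon) (.of_smul hP htP ?_)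
    rw [Algebra.smul_def, mul_inv_cancel₀ htK]
    simpa using MemLocalization.of_algebraMap (K := K) hP 1
  have h2 := hz _ h1
  rw [mul_inv_cancel_left₀ hz0] at h2
  exact MemLocalization.not_inv_algebraMap htM ht0 h2

namespace Ideal.IsBranchPrime

variable {P : Ideal R}

/-- At a maximal `N` not above `P`, the localization of `P` is `R_N`. At `N ⊇ P` it is `P_P`, the
maximal ideal of the valuation ring `R_P`, and only elements of `R_P` multiply it into `R_N`. -/
theorem mem_one_div_iff (hP : P.IsBranchPrime) (hR : IsPruferDomain R) {x : K} :
    x ∈ 1 / (P : FractionalIdeal R⁰ K) ↔ MemLocalization P 1 x ∧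
      ∀ N : Ideal R, N.IsMaximal → ¬ P ≤ N → MemLocalization N 1 x := by
  have hP0 : (P : FractionalIdeal R⁰ K) ≠ 0 := FractionalIdeal.coeIdeal_ne_zero.2 hP.ne_bot
  rw [StarOperation.mem_one_div hP0]
  constructor
  · intro h
    have hsmul : ∀ p ∈ P, p • x ∈ (1 : Submodule R K) := fun p hp => by
      have := h _ (FractionalIdeal.mem_coeIdeal_of_mem _ hp)
      rw [mul_comm, ← Algebra.smul_def, ← FractionalIdeal.mem_coe] at this
      simpa using this
    refine ⟨?_, fun N hN hPN => ?_⟩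
    · obtain ⟨M, N, hM, hN, hMN, hPM, hPN⟩ := hP.exists_two
      have hlt : P < M := lt_of_le_of_ne hPM fun h => hMN (hM.eq_of_le hN.ne_top (h ▸ hPN))
      by_contra hx
      have hx0 : x ≠ 0 := by
        rintro rfl; exact hx (.of_mem hP.isPrime (zero_mem _))
      obtain ⟨t, htM, htP⟩ := Set.exists_of_ssubset hlt
      have ht0 : t ≠ 0 := fun h => htP (h ▸ P.zero_mem)
      have htK : algebraMap R K t ≠ 0 := by simpa using ht0
      -- If `x ∉ R_P`, then `t⁻¹ x⁻¹ ∈ P_P ⊆ P_M`, and multiplying by `x` would put `t⁻¹` in `R_M`.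
      have h1 : MemLocalization P (P : FractionalIdeal R⁰ K) ((algebraMap R K t)⁻¹ * x⁻¹) := by
        refine .mul hP.isPrime (.of_smul hP.isPrime htP ?_)
          (hR.memLocalization_inv_mem hP.isPrime hx)
        rw [Algebra.smul_def, mul_inv_cancel₀ htK]
        simpa using MemLocalization.of_algebraMap (K := K) hP.isPrime 1
      obtain ⟨s, hs, hsy⟩ := hR.memLocalization_of_le hP.isPrime hM.isPrime hPM h1
      refine MemLocalization.not_inv_algebraMap htM ht0 (K := K) ⟨s, hs, ?_⟩
      have := h _ hsy
      have e : x * s • ((algebraMap R K t)⁻¹ * x⁻¹) = s • (algebraMap R K t)⁻¹ := by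
        simp only [Algebra.smul_def]; field_simp
      rw [e, ← FractionalIdeal.mem_coe] at this
      simpa using this
    · obtain ⟨p, hp, hpN⟩ := Set.not_subset.1 hPN
      exact ⟨p, hpN, hsmul p hp⟩
  · rintro ⟨hx, hxN⟩ y hy
    rw [← FractionalIdeal.mem_coe, FractionalIdeal.coe_one]
    refine MemLocalization.mem_of_forall_maximal fun N hN => ?_
    by_cases hPN : P ≤ N
    · refine (hR.memLocalization_of_le hP.isPrime hN.isPrime hPN
        (.mul hP.isPrime hx (.of_mem hP.isPrime hy))).mono ?_
      rw [← FractionalIdeal.coe_one]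
      exact FractionalIdeal.coeIdeal_le_one
    · obtain ⟨p, -, rfl⟩ := (FractionalIdeal.mem_coeIdeal _).1 hy
      exact .mul hN.isPrime (hxN N hN hPN) (.of_algebraMap hN.isPrime p)

end Ideal.IsBranchPrime

/-- In a locally finite Prüfer domain that is not h-local, there are `I`, `J` with `I ⊓ J` and
`I + J` divisorial but `I` not divisorial. -/
theorem IsPruferDomain.exists_not_isClosed_vOperation (hR : IsPruferDomain R)
    (hfin : IsLocallyFiniteDomain R) (h : ¬ IsHLocalDomain R) :
    ∃ I J : FractionalIdeal R⁰ K, ¬ (StarOperation.vOperation R K).IsClosed I ∧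
      (StarOperation.vOperation R K).IsClosed (I ⊓ J) ∧
      (StarOperation.vOperation R K).IsClosed (I + J) := by
  obtain ⟨P, hP⟩ := hR.exists_isBranchPrime hfin h
  obtain ⟨M₁, M₂, hM₁, hM₂, hne, hP₁, hP₂⟩ := hP.exists_two
  have hlt₁ : P < M₁ := lt_of_le_of_ne hP₁ fun h => hne (hM₁.eq_of_le hM₂.ne_top (h ▸ hP₂))
  have hlt₂ : P < M₂ := lt_of_le_of_ne hP₂ fun h => hne.symm (hM₂.eq_of_le hM₁.ne_top (h ▸ hP₁))
  have hP0 : (P : FractionalIdeal R⁰ K) ≠ 0 := FractionalIdeal.coeIdeal_ne_zero.2 hP.ne_bot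
  set D : FractionalIdeal R⁰ K := 1 / (P : FractionalIdeal R⁰ K) with hD
  have memD : ∀ {x : K}, x ∈ D ↔ MemLocalization P 1 x ∧
      ∀ N : Ideal R, N.IsMaximal → ¬ P ≤ N → MemLocalization N 1 x := hP.mem_one_div_iff hR
  have hDv : (StarOperation.vOperation R K).IsClosed D := by
    change 1 / (1 / D) = D
    have h1 := StarOperation.one_div_ne_zero hP0
    exact le_antisymm (StarOperation.one_div_anti hP0 (StarOperation.one_div_ne_zero h1)
      (StarOperation.le_one_div_one_div hP0)) (StarOperation.le_one_div_one_div h1)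
  -- Locally, `I` shrinks `D` from `R_P` to `R_{M₁}` at `M₁` only, while `J` keeps `R_P` at `M₁` and
  -- is cut down to `R_N` elsewhere.
  let I := D.restrictLocal {M₁} (by rintro N rfl; exact hM₁.isPrime)
  let J := D.restrictLocal {N | N.IsMaximal ∧ N ≠ M₁} (fun N hN => hN.1.isPrime)
  have memI : ∀ {x : K}, x ∈ I ↔ x ∈ D ∧ MemLocalization M₁ 1 x := by
    intro x; simp [I, FractionalIdeal.mem_restrictLocal]
  have memJ : ∀ {x : K}, x ∈ J ↔ x ∈ D ∧
      ∀ N : Ideal R, N.IsMaximal → N ≠ M₁ → MemLocalization N 1 x := by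
    intro x; simp [J, FractionalIdeal.mem_restrictLocal]
  have hID : I ≤ D := fun x hx => (memI.1 hx).1
  have hJD : J ≤ D := fun x hx => (memJ.1 hx).1
  have one_mem : (1 : K) ∈ I := by
    have h1 : ∀ N : Ideal R, N.IsPrime → MemLocalization N 1 (1 : K) := fun N hN => by
      simpa using MemLocalization.of_algebraMap (K := K) hN 1
    exact memI.2 ⟨memD.2 ⟨h1 P hP.isPrime, fun N hN _ => h1 N hN.isPrime⟩, h1 M₁ hM₁.isPrime⟩
  have hI0 : I ≠ 0 := by
    intro h0
    rw [h0, FractionalIdeal.mem_zero_iff] at one_mem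
    exact one_ne_zero one_mem
  -- membership of multiples of elements of `R_P`
  have smulI : ∀ M : Ideal R, M.IsMaximal → P ≤ M → M ≠ M₁ → ∀ x : K, MemLocalization P 1 x →
      MemLocalization M (I : Submodule R K) x := fun M hM hPM hM₁' x hx => by
    obtain ⟨s, hs, hsN⟩ := hP.exists_notMem_forall_memLocalization hfin hM hPM hx
    exact ⟨s, hs, memI.2 ⟨memD.2 ⟨hx.smul s, fun N hN hPN =>
      hsN N hN fun e => hPN (e ▸ hPM)⟩, hsN M₁ hM₁ (Ne.symm hM₁')⟩⟩
  have smulJ : ∀ x : K, MemLocalization P 1 x → ∃ s ∉ M₁, s • x ∈ J := fun x hx => by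
    obtain ⟨s, hs, hsN⟩ := hP.exists_notMem_forall_memLocalization hfin hM₁ hP₁ hx
    exact ⟨s, hs, memJ.2 ⟨memD.2 ⟨hx.smul s, fun N hN hPN =>
      hsN N hN fun e => hPN (e ▸ hP₁)⟩, hsN⟩⟩
  have hinf : I ⊓ J = 1 := by
    apply FractionalIdeal.coeToSubmodule_injective
    change ((I ⊓ J : FractionalIdeal R⁰ K) : Submodule R K) = ((1 : FractionalIdeal R⁰ K) : _)
    rw [FractionalIdeal.coe_inf, FractionalIdeal.coe_one]
    apply le_antisymm
    · rintro x ⟨hxI, hxJ⟩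
      refine MemLocalization.mem_of_forall_maximal fun N hN => ?_
      by_cases e : N = M₁
      · exact e ▸ (memI.1 hxI).2
      · exact (memJ.1 hxJ).2 N hN e
    · intro x hx
      have h1 : ∀ N : Ideal R, N.IsPrime → MemLocalization N 1 x := fun N hN => .of_mem hN hx
      have hxD : x ∈ D := memD.2 ⟨h1 P hP.isPrime, fun N hN _ => h1 N hN.isPrime⟩
      exact ⟨memI.2 ⟨hxD, h1 M₁ hM₁.isPrime⟩, memJ.2 ⟨hxD, fun N hN _ => h1 N hN.isPrime⟩⟩
  have hadd : I + J = D := by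
    refine le_antisymm (by rw [← FractionalIdeal.sup_eq_add]; exact sup_le hID hJD) fun x hx => ?_
    have hx' := memD.1 hx
    have hIle : I ≤ I + J := by rw [← FractionalIdeal.sup_eq_add]; exact le_sup_left
    have hJle : J ≤ I + J := by rw [← FractionalIdeal.sup_eq_add]; exact le_sup_right
    refine MemLocalization.mem_of_forall_maximal
      (L := ((I + J : FractionalIdeal R⁰ K) : Submodule R K)) fun N hN => ?_
    by_cases hPN : P ≤ N
    · by_cases e : N = M₁
      · obtain ⟨s, hs, hsx⟩ := smulJ x hx'.1
        exact ⟨s, e ▸ hs, hJle hsx⟩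
      · exact (smulI N hN hPN e x hx'.1).mono hIle
    · refine (hx'.2 N hN hPN).mono fun y hy => hIle ?_
      obtain ⟨r, rfl⟩ := Submodule.mem_one.1 hy
      have := (I : Submodule R K).smul_mem r one_mem
      rwa [Algebra.smul_def, mul_one] at this
  -- If `zI ⊆ R`, then `z R_P ⊆ R_{M₂}` because `R_P ⊆ I_{M₂}`; so `z ∈ P_P`, and `zD ⊆ P_P ⊆ R_N`
  -- for every maximal `N ⊇ P`. At other `N`, `z ∈ R` suffices, as `1 ∈ I`.
  have hdiv : 1 / I = 1 / D := by
    have hD0 : D ≠ 0 := StarOperation.one_div_ne_zero hP0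
    refine le_antisymm (fun z hz => ?_) (StarOperation.one_div_anti hI0 hD0 hID)
    rw [StarOperation.mem_one_div hI0] at hz
    have hzI : ∀ N : Ideal R, ∀ w : K, MemLocalization N (I : Submodule R K) w →
        MemLocalization N 1 (z * w) := by
      rintro N w ⟨s, hs, hsw⟩
      refine ⟨s, hs, ?_⟩
      have := hz _ hsw
      rw [mul_smul_comm, ← FractionalIdeal.mem_coe, FractionalIdeal.coe_one] at this
      exact this
    have hzP := hR.memLocalization_of_forall_mul hP.isPrime hlt₂
      fun w hw => hzI M₂ w (smulI M₂ hM₂ hP₂ hne.symm w hw)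
    rw [StarOperation.mem_one_div hD0]
    intro w hw
    have hw' := memD.1 hw
    rw [← FractionalIdeal.mem_coe, FractionalIdeal.coe_one]
    refine MemLocalization.mem_of_forall_maximal fun N hN => ?_
    by_cases hPN : P ≤ N
    · rw [mul_comm]
      refine (hR.memLocalization_of_le hP.isPrime hN.isPrime hPN (hw'.1.mul hP.isPrime hzP)).mono ?_
      rw [← FractionalIdeal.coe_one]
      exact FractionalIdeal.coeIdeal_le_one
    · refine (hw'.2 N hN hPN).mul hN.isPrime ?_ |> fun h => by rwa [mul_comm]
      have := hz _ one_mem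
      rw [mul_one, ← FractionalIdeal.mem_coe, FractionalIdeal.coe_one] at this
      exact .of_mem hN.isPrime this
  refine ⟨I, J, fun hI => ?_, ?_, hadd.symm ▸ hDv⟩
  · have hIeq : I = D := by
      rw [← hI, ← hDv]
      change 1 / (1 / I) = 1 / (1 / D)
      rw [hdiv]
    -- Some `s t⁻¹` with `s ∉ M₁` lies in `J ⊆ D`; were `I = D`, then `t⁻¹` would lie in `R_{M₁}`.
    obtain ⟨t, htM, htP⟩ := Set.exists_of_ssubset hlt₁
    have ht0 : t ≠ 0 := fun h => htP (h ▸ P.zero_mem)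
    have htK : algebraMap R K t ≠ 0 := by simpa using ht0
    obtain ⟨s, hs, hsJ⟩ := smulJ (algebraMap R K t)⁻¹ (.of_smul hP.isPrime htP (by
      rw [Algebra.smul_def, mul_inv_cancel₀ htK]
      simpa using MemLocalization.of_algebraMap (K := K) hP.isPrime 1))
    exact MemLocalization.not_inv_algebraMap htM ht0
      (.of_smul hM₁.isPrime hs (memI.1 (hIeq ▸ hJD hsJ)).2)
  · rw [hinf]
    exact (StarOperation.vOperation R K).map_one

end Divisorial

theorem mainTheorem7 (R : Type*) [CommRing R] [IsDomain R] (K : Type*) [Field K] [Algebra R K]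
    [IsFractionRing R K] (hR : IsPruferDomain R)
    (h : Finite (MaximalSpectrum R) ∨ (IsLocallyFiniteDomain R ∧ FiniteRingKrullDim R)) :
    List.TFAE [
      IsHLocalDomain R,
      ∀ (s : StarOperation R K) (I J : FractionalIdeal R⁰ K), ¬ s.IsClosed I →
        (¬ s.IsClosed (I ⊓ J) ∨ ¬ s.IsClosed (I + J)),
      ∀ I J : FractionalIdeal R⁰ K, ¬ (StarOperation.vOperation R K).IsClosed I →
        (¬ (StarOperation.vOperation R K).IsClosed (I ⊓ J) ∨
          ¬ (StarOperation.vOperation R K).IsClosed (I + J))] := by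
  have hfin : IsLocallyFiniteDomain R :=
    h.elim IsLocallyFiniteDomain.of_finite_maximalSpectrum And.left
  tfae_have 1 → 2 := fun hloc s I J hI => by
    by_contra! hIJ
    exact hI (hloc.isClosed_of_inf_of_add hR s hIJ.1 hIJ.2)
  tfae_have 2 → 3 := fun h2 => h2 (StarOperation.vOperation R K)
  tfae_have 3 → 1 := fun h3 => by
    by_contra hloc
    obtain ⟨I, J, hI, hinf, hadd⟩ := hR.exists_not_isClosed_vOperation (K := K) hfin hloc
    exact (h3 I J hI).elim (· hinf) (· hadd)
  tfae_finish
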